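/- For coprime integers $d, c$ with $c > 0$ define the Hardy sums $$S(d,c) = \sum_{k=1}^{c-1} (-1)^{k+1+\lfloor dk/c \rfloor}, \qquad S_4(d,c) = \sum_{k=1}^{c-1} (-1)^{\lfloor dk/c \rfloor},$$ which are integers. Then the set $$\{(d/c,\, S(d,c)) : d, c \in \mathbf{Z},\ (d,c) = 1,\ c > 0,\ c + d \text{ odd}\}$$ is dense in $\mathbb{R} \times \mathbf{Z}$, where $\mathbf{Z}$ carries the discrete topology, and the set $$\{(d/c,\, S_4(d,c)) : d, c \in \mathbf{Z},\ (d,c) = 1,\ c > 0,\ d \text{ odd}\}$$ is dense in $\mathbb{R} \times \mathbf{Z}$ as well. That is, for every $x \in \mathbb{R}$, $m \in \mathbf{Z}$ and $\varepsilon > 0$ there is such a pair $(d,c)$ with $|x - d/c| < \varepsilon$ and $S(d,c) = m$, and likewise for $S_4$. -/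

import Mathlib

/-- The Hardy sum `S(d, c) = ∑_{k=1}^{c-1} (-1)^(k + 1 + ⌊dk/c⌋)`, an integer.
It is meant for `c > 0` and `d`, `c` coprime. The exponent may be negative. -/
noncomputable def hardyS (d c : ℤ) : ℤ :=
  ∑ k ∈ Finset.Icc 1 (c - 1), (Int.negOnePow (k + 1 + ⌊((d * k : ℤ) : ℚ) / (c : ℚ)⌋) : ℤ)

/-- The Hardy sum `S₄(d, c) = ∑_{k=1}^{c-1} (-1)^⌊dk/c⌋`, an integer.
It is meant for `c > 0` and `d`, `c` coprime. The exponent may be negative. -/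
noncomputable def hardyS4 (d c : ℤ) : ℤ :=
  ∑ k ∈ Finset.Icc 1 (c - 1), (Int.negOnePow ⌊((d * k : ℤ) : ℚ) / (c : ℚ)⌋ : ℤ)

/-!
The sums `S(d, c)` with `d + c` odd depend only on `r = d / c` and satisfy three rules, which make
them computable along the action of the theta group on the rationals:

* `S(r + 2) = S(r)` (`hardyS_add_two_mul`),
* `S(-r) = -S(r)` (`hardyS_neg`),
* `S(r) + S(1 / r) = 1` for `r > 0` (`hardyS_reciprocity`).

The reciprocity law holds because `k + ⌊dk/c⌋` counts the multiples of `d` or of `c` in `(0, dk]`: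
going through all the multiples of `d` or of `c` in `(0, cd)`, this count takes each of the values
`1, …, c + d - 2` once, so `S(d, c) + S(c, d)` is an alternating sum with an odd number of terms.

Let `X m` (`hardyLevel m`) be the set of fractions with `S = m`. Since `S(k / (k + 1)) = k`, every
`X m` has an element in `[-1, 1]`. Given `z ∈ X (1 - m)` there, the points `1 / (2 n + z)` lie in
`X m` and tend to `0`, so `0` is in the closure of every `X m`. The three rules move this property
from `0` to every fraction `d / c` with `d + c` odd, by a Euclidean algorithm with even quotients
(`mem_closure_hardyLevel`). These fractions are dense in `ℝ`, hence so is each `X m`.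

For `S₄` it suffices to note that `S₄(d + c, c) = -S(d, c)`.
-/

/-! ### Elementary properties of the Hardy sums -/

lemma floor_intCast_div (a : ℤ) {c : ℤ} (hc : 0 ≤ c) : ⌊(a : ℚ) / (c : ℚ)⌋ = a / c := by
  lift c to ℕ using hc
  exact Rat.floor_intCast_div_natCast a c

lemma hardyS_eq (d c : ℤ) :
    hardyS d c = ∑ k ∈ Finset.Icc 1 (c - 1), (Int.negOnePow (k + 1 + d * k / c) : ℤ) := by
  refine Finset.sum_congr rfl fun k hk => ?_
  rw [Finset.mem_Icc] at hk
  rw [floor_intCast_div _ (by omega)]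

lemma hardyS4_eq (d c : ℤ) :
    hardyS4 d c = ∑ k ∈ Finset.Icc 1 (c - 1), (Int.negOnePow (d * k / c) : ℤ) := by
  refine Finset.sum_congr rfl fun k hk => ?_
  rw [Finset.mem_Icc] at hk
  rw [floor_intCast_div _ (by omega)]

lemma hardyS4_add_self {c : ℤ} (hc : 0 < c) (d : ℤ) : hardyS4 (d + c) c = -hardyS d c := by
  rw [hardyS4_eq, hardyS_eq, ← Finset.sum_neg_distrib]
  refine Finset.sum_congr rfl fun k _ => ?_
  have h : (d + c) * k / c = d * k / c + k := by
    rw [show (d + c) * k = d * k + k * c by ring, Int.add_mul_ediv_right _ _ hc.ne']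
  rw [h, show k + 1 + d * k / c = d * k / c + k + 1 by ring, Int.negOnePow_succ]
  simp

lemma hardyS_add_two_mul {c : ℤ} (hc : 0 < c) (d n : ℤ) :
    hardyS (d + 2 * n * c) c = hardyS d c := by
  rw [hardyS_eq, hardyS_eq]
  refine Finset.sum_congr rfl fun k _ => ?_
  have h : (d + 2 * n * c) * k / c = d * k / c + 2 * (n * k) := by
    rw [show (d + 2 * n * c) * k = d * k + 2 * (n * k) * c by ring,
      Int.add_mul_ediv_right _ _ hc.ne']
  rw [h, ← add_assoc, Int.negOnePow_add, Int.negOnePow_two_mul, mul_one]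

lemma not_dvd_mul_of_mem_Icc {d c k : ℤ} (h : IsCoprime d c) (hk : k ∈ Finset.Icc 1 (c - 1)) :
    ¬ c ∣ d * k := by
  rw [Finset.mem_Icc] at hk
  intro hdvd
  have := Int.le_of_dvd (by omega) (h.symm.dvd_of_dvd_mul_left hdvd)
  omega

lemma hardyS_neg {d c : ℤ} (h : IsCoprime d c) (hc : 0 < c) :
    hardyS (-d) c = -hardyS d c := by
  rw [hardyS_eq, hardyS_eq, ← Finset.sum_neg_distrib]
  refine Finset.sum_congr rfl fun k hk => ?_
  have h1 : -d * k / c = -(d * k / c) - 1 := by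
    rw [neg_mul, Int.neg_ediv, if_neg (not_dvd_mul_of_mem_Icc h hk), Int.sign_eq_one_of_pos hc]
  have h2 : k + 1 + d * k / c = (k + 1 + -d * k / c) + 1 + 2 * (d * k / c) := by
    rw [h1]; ring
  rw [h2, Int.negOnePow_add _ (2 * _), Int.negOnePow_two_mul, mul_one, Int.negOnePow_succ]
  simp

lemma hardyS_self_add_one (k : ℕ) : hardyS k (k + 1) = k := by
  rw [hardyS_eq]
  have h : ∀ j ∈ Finset.Icc (1 : ℤ) (k + 1 - 1),
      (Int.negOnePow (j + 1 + k * j / (k + 1)) : ℤ) = 1 := by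
    intro j hj
    rw [Finset.mem_Icc] at hj
    have h1 : (k : ℤ) * j / (k + 1) = j - 1 := by
      rw [Int.ediv_eq_iff_of_pos (by omega)]
      constructor <;> nlinarith
    rw [h1, show j + 1 + (j - 1) = 2 * j by ring, Int.negOnePow_two_mul]
    rfl
  rw [Finset.sum_congr rfl h]
  simp

/-! ### The reciprocity law -/

/-- The floors of the multiples of `(c + d) / c` strictly between `0` and `c + d`. The sets
`beattySet d c` and `beattySet c d` partition `{1, …, c + d - 2}`: this is a finite form of
Beatty's theorem. -/
noncomputable def beattySet (d c : ℤ) : Finset ℤ :=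
  (Finset.Icc 1 (c - 1)).image fun k => k + d * k / c

lemma strictMono_add_mul_ediv {d c : ℤ} (hd : 0 < d) (hc : 0 < c) :
    StrictMono fun k : ℤ => k + d * k / c := by
  intro a b hab
  have : d * a / c ≤ d * b / c := Int.ediv_le_ediv hc (by nlinarith)
  simp only
  omega

lemma card_beattySet {d c : ℤ} (hd : 0 < d) (hc : 0 < c) :
    (beattySet d c).card = (c - 1).toNat := by
  rw [beattySet, Finset.card_image_of_injective _ (strictMono_add_mul_ediv hd hc).injective]
  simp

lemma hardyS_eq_sum_beattySet {d c : ℤ} (hd : 0 < d) (hc : 0 < c) :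
    hardyS d c = ∑ n ∈ beattySet d c, (Int.negOnePow (n + 1) : ℤ) := by
  rw [beattySet, Finset.sum_image (strictMono_add_mul_ediv hd hc).injective.injOn, hardyS_eq]
  exact Finset.sum_congr rfl fun k _ => by rw [add_right_comm]

lemma beattySet_subset {d c : ℤ} (hd : 0 < d) (hc : 0 < c) :
    beattySet d c ⊆ Finset.Icc 1 (c + d - 2) := by
  intro n hn
  obtain ⟨k, hk, rfl⟩ := Finset.mem_image.1 hn
  rw [Finset.mem_Icc] at hk ⊢
  have h0 : 0 ≤ d * k / c := Int.ediv_nonneg (by nlinarith) hc.le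
  have h1 : d * k / c < d := Int.ediv_lt_of_lt_mul hc (by nlinarith)
  omega

lemma disjoint_beattySet {d c : ℤ} (h : IsCoprime d c) (hd : 0 < d) (hc : 0 < c) :
    Disjoint (beattySet d c) (beattySet c d) := by
  rw [Finset.disjoint_left]
  intro n hn hn'
  obtain ⟨k, hk, rfl⟩ := Finset.mem_image.1 hn
  obtain ⟨j, hj, hjk⟩ := Finset.mem_image.1 hn'
  -- The smaller of the multiples `d * k` and `c * j` is counted strictly before the larger one.
  rcases lt_trichotomy (d * k) (c * j) with hlt | heq | hgt
  · have h1 : d * k / c < j := Int.ediv_lt_of_lt_mul hc (by linarith)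
    have h2 : k ≤ c * j / d := Int.le_ediv_of_mul_le hd (by linarith)
    omega
  · exact not_dvd_mul_of_mem_Icc h hk ⟨j, heq⟩
  · have h1 : c * j / d < k := Int.ediv_lt_of_lt_mul hd (by linarith)
    have h2 : j ≤ d * k / c := Int.le_ediv_of_mul_le hc (by linarith)
    omega

lemma beattySet_union {d c : ℤ} (h : IsCoprime d c) (hd : 0 < d) (hc : 0 < c) :
    beattySet d c ∪ beattySet c d = Finset.Icc 1 (c + d - 2) := by
  refine Finset.eq_of_subset_of_card_le (Finset.union_subset (beattySet_subset hd hc) ?_) ?_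
  · rw [add_comm c d]
    exact beattySet_subset hc hd
  · rw [Finset.card_union_of_disjoint (disjoint_beattySet h hd hc), card_beattySet hd hc,
      card_beattySet hc hd, Int.card_Icc]
    omega

lemma sum_negOnePow_Icc (n : ℕ) :
    ∑ k ∈ Finset.Icc (1 : ℤ) (2 * n + 1), (Int.negOnePow (k + 1) : ℤ) = 1 := by
  induction n with
  | zero => simp [Int.negOnePow_succ]
  | succ n ih =>
    have h : Finset.Icc (1 : ℤ) (2 * (n + 1 : ℕ) + 1) =
        insert (2 * n + 3 : ℤ) (insert (2 * n + 2 : ℤ) (Finset.Icc (1 : ℤ) (2 * n + 1))) := by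
      ext x
      simp only [Finset.mem_Icc, Finset.mem_insert]
      push_cast
      omega
    rw [h, Finset.sum_insert (by simp), Finset.sum_insert (by simp), ih,
      show (2 * n + 3 + 1 : ℤ) = 2 * n + 2 + 1 + 1 by ring, Int.negOnePow_succ (2 * n + 2 + 1)]
    simp

lemma hardyS_reciprocity {d c : ℤ} (h : IsCoprime d c) (hd : 0 < d) (hc : 0 < c)
    (hodd : Odd (d + c)) : hardyS d c + hardyS c d = 1 := by
  rw [hardyS_eq_sum_beattySet hd hc, hardyS_eq_sum_beattySet hc hd,
    ← Finset.sum_union (disjoint_beattySet h hd hc), beattySet_union h hd hc]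
  obtain ⟨t, ht⟩ := hodd
  have hlast : c + d - 2 = 2 * ((t - 1).toNat : ℤ) + 1 := by omega
  rw [hlast, sum_negOnePow_Icc]

/-! ### The level sets of the Hardy sum -/

/-- The set of the fractions `d / c` in lowest terms, with `d + c` odd, for which
`S(d, c) = m`. -/
def hardyLevel (m : ℤ) : Set ℝ :=
  {x | ∃ d c : ℤ, IsCoprime d c ∧ 0 < c ∧ Odd (d + c) ∧ hardyS d c = m ∧ x = (d : ℝ) / c}

lemma add_two_mul_mem_hardyLevel {m : ℤ} {x : ℝ} (hx : x ∈ hardyLevel m) (n : ℤ) :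
    x + 2 * n ∈ hardyLevel m := by
  obtain ⟨d, c, h, hc, hodd, hm, rfl⟩ := hx
  refine ⟨d + 2 * n * c, c, h.add_mul_right_left _, hc, ?_, ?_, ?_⟩
  · rw [show d + 2 * n * c + c = d + c + 2 * (n * c) by ring]
    exact hodd.add_even (even_two_mul _)
  · rw [hardyS_add_two_mul hc, hm]
  · have : (c : ℝ) ≠ 0 := by exact_mod_cast hc.ne'
    push_cast
    field_simp

lemma neg_mem_hardyLevel {m : ℤ} {x : ℝ} (hx : x ∈ hardyLevel m) : -x ∈ hardyLevel (-m) := by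
  obtain ⟨d, c, h, hc, hodd, rfl, rfl⟩ := hx
  refine ⟨-d, c, h.neg_left, hc, ?_, hardyS_neg h hc, by push_cast; ring⟩
  rw [Int.odd_iff] at hodd ⊢
  omega

lemma inv_mem_hardyLevel {m : ℤ} {x : ℝ} (hx : x ∈ hardyLevel m) (h0 : 0 < x) :
    x⁻¹ ∈ hardyLevel (1 - m) := by
  obtain ⟨d, c, h, hc, hodd, rfl, rfl⟩ := hx
  have hc' : (0 : ℝ) < c := by exact_mod_cast hc
  have hd : 0 < d := by exact_mod_cast (div_pos_iff_of_pos_right hc').1 h0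
  refine ⟨c, d, h.symm, hd, by rwa [add_comm], ?_, by rw [inv_div]⟩
  linarith [hardyS_reciprocity h hd hc hodd]

lemma exists_mem_hardyLevel (m : ℤ) : ∃ x ∈ hardyLevel m, |x| ≤ 1 := by
  have key : ∀ k : ℕ, ∃ x ∈ hardyLevel k, |x| ≤ 1 := by
    intro k
    refine ⟨(k : ℝ) / (k + 1), ⟨k, k + 1, ⟨-1, 1, by ring⟩, by omega, ⟨k, by ring⟩,
      hardyS_self_add_one k, by push_cast; rfl⟩, ?_⟩
    rw [abs_of_nonneg (by positivity)]
    exact div_le_one_of_le₀ (by linarith) (by positivity)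
  obtain ⟨k, rfl | rfl⟩ := Int.eq_nat_or_neg m
  · exact key k
  · obtain ⟨x, hx, hx1⟩ := key k
    exact ⟨-x, neg_mem_hardyLevel hx, by rwa [abs_neg]⟩

/-! ### Closures of the level sets -/

lemma zero_mem_closure_hardyLevel (m : ℤ) : (0 : ℝ) ∈ closure (hardyLevel m) := by
  obtain ⟨z, hz, hz1⟩ := exists_mem_hardyLevel (1 - m)
  have hlim : Filter.Tendsto (fun n : ℕ => (z + 2 * ((n : ℤ) : ℝ))⁻¹) Filter.atTop (nhds 0) := by
    refine Filter.Tendsto.inv_tendsto_atTop (Filter.tendsto_atTop_add_const_left _ _ ?_)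
    simp only [Int.cast_natCast]
    exact tendsto_natCast_atTop_atTop.const_mul_atTop two_pos
  refine mem_closure_of_tendsto hlim ?_
  filter_upwards [Filter.eventually_ge_atTop 1] with n hn
  have hn' : (1 : ℝ) ≤ n := by exact_mod_cast hn
  have h := inv_mem_hardyLevel (add_two_mul_mem_hardyLevel hz n)
    (by push_cast; linarith [neg_le_of_abs_le hz1])
  rwa [sub_sub_cancel] at h

lemma add_two_mul_mem_closure_hardyLevel {m : ℤ} {x : ℝ} (hx : x ∈ closure (hardyLevel m))
    (n : ℤ) : x + 2 * n ∈ closure (hardyLevel m) :=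
  map_mem_closure (f := fun y : ℝ => y + 2 * n) (by fun_prop) hx
    fun _ hy => add_two_mul_mem_hardyLevel hy n

lemma neg_mem_closure_hardyLevel {m : ℤ} {x : ℝ} (hx : x ∈ closure (hardyLevel m)) :
    -x ∈ closure (hardyLevel (-m)) :=
  map_mem_closure continuous_neg hx fun _ hy => neg_mem_hardyLevel hy

lemma inv_mem_closure_hardyLevel {m : ℤ} {x : ℝ} (hx : x ∈ closure (hardyLevel m))
    (h0 : 0 < x) : x⁻¹ ∈ closure (hardyLevel (1 - m)) := by
  rw [mem_closure_iff_frequently] at hx ⊢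
  refine (continuousAt_inv₀ h0.ne').frequently ?_
  exact (hx.and_eventually (lt_mem_nhds h0)).mono fun y hy => inv_mem_hardyLevel hy.1 hy.2

/-- The Euclidean algorithm with even quotients: subtracting an even multiple of `c` from `d`
makes `|d| < c`, equality being excluded by parity, and inversion then lowers the denominator. -/
lemma mem_closure_hardyLevel (d c : ℤ) (h : IsCoprime d c) (hc : 0 < c) (hodd : Odd (d + c))
    (m : ℤ) : (d : ℝ) / c ∈ closure (hardyLevel m) := by
  induction hN : c.toNat using Nat.strong_induction_on generalizing d c m with
  | _ N ih =>
  subst hN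
  have hc0 : (c : ℝ) ≠ 0 := by exact_mod_cast hc.ne'
  -- The case `0 < e < c`, for all `m` at once, since negation and inversion change `m`.
  have pos : ∀ e : ℤ, IsCoprime e c → Odd (e + c) → 0 < e → e < c → ∀ m : ℤ,
      (e : ℝ) / c ∈ closure (hardyLevel m) := by
    intro e he heo he0 hec m
    have h1 := ih e.toNat (by omega) c e he.symm he0 (by rwa [add_comm]) (1 - m) rfl
    have h2 := inv_mem_closure_hardyLevel h1
      (div_pos (by exact_mod_cast hc) (by exact_mod_cast he0))
    rwa [inv_div, sub_sub_cancel] at h2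
  have small : ∀ e : ℤ, IsCoprime e c → Odd (e + c) → |e| < c →
      (e : ℝ) / c ∈ closure (hardyLevel m) := by
    intro e he heo hec
    rw [abs_lt] at hec
    rcases lt_trichotomy e 0 with hneg | rfl | hpos
    · have h1 := neg_mem_closure_hardyLevel (pos (-e) he.neg_left
        (by rw [Int.odd_iff] at heo ⊢; omega) (by omega) (by omega) (-m))
      rw [neg_neg] at h1
      convert h1 using 1
      push_cast
      ring
    · rw [Int.cast_zero, zero_div]
      exact zero_mem_closure_hardyLevel m
    · exact pos e he heo hpos hec.2 m
  set n : ℤ := (d + c) / (2 * c) with hn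
  -- `e + c` is the remainder of `d + c` modulo `2 * c`, so `e` lies in `[-c, c)`.
  set e : ℤ := d + 2 * (-n) * c with he
  have hr1 : 0 ≤ (d + c) % (2 * c) := Int.emod_nonneg _ (by omega)
  have hr2 : (d + c) % (2 * c) < 2 * c := Int.emod_lt_of_pos _ (by omega)
  have hr3 : e + c = (d + c) % (2 * c) := by
    rw [Int.emod_def, ← hn, he]
    ring
  have heo : Odd (e + c) := by
    rw [he, show d + 2 * (-n) * c + c = d + c + 2 * (-n * c) by ring]
    exact hodd.add_even (even_two_mul _)
  have hlt : |e| < c := by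
    rw [Int.odd_iff] at heo
    rw [abs_lt]
    constructor <;> omega
  have h1 := add_two_mul_mem_closure_hardyLevel
    (small e (h.add_mul_right_left _) heo hlt) n
  convert h1 using 1
  rw [he]
  push_cast
  field_simp
  ring

/-- Fractions with odd numerator and a power of two as denominator are already dense. -/
lemma exists_div_mem_ball (x : ℝ) {ε : ℝ} (hε : 0 < ε) :
    ∃ d c : ℤ, IsCoprime d c ∧ 0 < c ∧ Odd (d + c) ∧ (d : ℝ) / c ∈ Metric.ball x ε := by
  obtain ⟨n, hn⟩ := exists_pow_lt_of_lt_one hε (show (1 / 2 : ℝ) < 1 by norm_num)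
  have h2 : (0 : ℝ) < 2 ^ n := by positivity
  have hodd : Odd (2 * ⌊x * 2 ^ n⌋ + 1) := ⟨_, rfl⟩
  refine ⟨2 * ⌊x * 2 ^ n⌋ + 1, 2 ^ (n + 1), ?_, by positivity, ?_, ?_⟩
  · exact (Int.isCoprime_two_right.2 hodd).pow_right
  · exact hodd.add_even (by simp [pow_succ])
  · have hle := Int.floor_le (x * 2 ^ n)
    have hlt := Int.lt_floor_add_one (x * 2 ^ n)
    have hn' : 1 < ε * 2 ^ n := by
      rwa [one_div, inv_pow, inv_lt_iff_one_lt_mul₀ h2] at hn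
    have hdist : ((2 * ⌊x * 2 ^ n⌋ + 1 : ℤ) : ℝ) / ((2 ^ (n + 1) : ℤ) : ℝ) - x =
        (⌊x * 2 ^ n⌋ + 1 / 2 - x * 2 ^ n) / 2 ^ n := by
      push_cast
      rw [pow_succ]
      field_simp
    rw [Metric.mem_ball, Real.dist_eq, hdist, abs_div, abs_of_pos h2, div_lt_iff₀ h2, abs_lt]
    constructor <;> linarith

lemma dense_hardyLevel (m : ℤ) : Dense (hardyLevel m) := by
  intro x
  rw [← closure_closure, Metric.mem_closure_iff]
  intro ε hε
  obtain ⟨d, c, h, hc, hodd, hx⟩ := exists_div_mem_ball x hε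
  exact ⟨_, mem_closure_hardyLevel d c h hc hodd m, by rwa [dist_comm]⟩

lemma dense_prod_of_forall_dense {X Y : Type*} [TopologicalSpace X] [TopologicalSpace Y]
    {s : Set (X × Y)} (h : ∀ y, Dense {x | (x, y) ∈ s}) : Dense s := by
  rintro ⟨x, y⟩
  exact map_mem_closure (f := fun z => (z, y)) (by fun_prop) (h y x) fun _ hz => hz

theorem theorem2 :
    Dense {p : ℝ × ℤ | ∃ d c : ℤ, IsCoprime d c ∧ 0 < c ∧ Odd (d + c) ∧
      p = ((d : ℝ) / (c : ℝ), hardyS d c)} ∧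
    Dense {p : ℝ × ℤ | ∃ d c : ℤ, IsCoprime d c ∧ 0 < c ∧ Odd d ∧
      p = ((d : ℝ) / (c : ℝ), hardyS4 d c)} := by
  constructor
  · refine dense_prod_of_forall_dense fun m => (dense_hardyLevel m).mono ?_
    rintro _ ⟨d, c, h, hc, hodd, rfl, rfl⟩
    exact ⟨d, c, h, hc, hodd, rfl⟩
  · refine dense_prod_of_forall_dense fun m => ?_
    -- Fractions for `S₄` are those of `hardyLevel (-m)`, translated by `1`.
    refine (((Homeomorph.addRight (1 : ℝ)).surjective.denseRange).dense_image
      (Homeomorph.addRight (1 : ℝ)).continuous (dense_hardyLevel (-m))).mono ?_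
    rintro _ ⟨_, ⟨d, c, h, hc, hodd, hm, rfl⟩, rfl⟩
    refine ⟨d + c, c, by simpa using h.add_mul_right_left 1, hc, hodd, ?_⟩
    have hc0 : (c : ℝ) ≠ 0 := by exact_mod_cast hc.ne'
    rw [hardyS4_add_self hc, hm, neg_neg, Homeomorph.coe_addRight]
    push_cast
    rw [add_div, div_self hc0]
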